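/- Let $H$ be a real separable Hilbert space, $Q:H\to H$ a positive self-adjoint trace class operator, and $\alpha\in(0,1/2)$. Write $\mathcal N(m,Q)$ for the law on $H$ with characteristic function $h\mapsto\exp\left(i\langle h,m\rangle-\tfrac12\langle Qh,h\rangle\right)$. Let $\chi_0\equiv 1$ and, for $n=2^k+l$ with $k\ge 0$, $0\le l\le 2^k-1$, let $\chi_n$ be the Haar function on $[0,1]$ equal to $\sqrt{2^k}$ on $[\frac{2l}{2^{k+1}},\frac{2l+1}{2^{k+1}})$, to $-\sqrt{2^k}$ on $[\frac{2l+1}{2^{k+1}},\frac{2l+2}{2^{k+1}}]$ and to $0$ elsewhere; let $\phi_n(t)=\int_0^t\chi_n(s)\,ds$ be the Schauder functions. For $F:[0,1]\to H$ put $\|F\|_\alpha=\sup_{0\le s<t\le 1}\frac{\|F(t)-F(s)\|}{|t-s|^\alpha}$, let $C^0_\alpha([0,1];H)$ be the set of $F$ with $F(0)=0$ and $\lim_{\delta\to 0}\sup_{0<|t-s|<\delta}\frac{\|F(t)-F(s)\|}{|t-s|^\alpha}=0$, and define $$T^H_\alpha(F)=\left(c_n(\alpha)\int_{[0,1]}\chi_n\,dF\right)_{n\ge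 0},\qquad c_0(\alpha)=1,\quad c_{2^k+l}(\alpha)=2^{k(\alpha-1/2)+\alpha-1},$$ where $\int_{[0,1]}\chi_0\,dF=F(1)-F(0)$ and $\int_{[0,1]}\chi_{2^k+l}\,dF=\sqrt{2^k}\left[2F(\tfrac{2l+1}{2^{k+1}})-F(\tfrac{2l+2}{2^{k+1}})-F(\tfrac{2l}{2^{k+1}})\right]$. Let $(Z_n)_{n\ge 0}$ be independent $\mathcal N(0,Q)$-distributed $H$-valued random variables on a probability space. Then almost surely the series $$W_t=\sum_{n=0}^\infty\phi_n(t)Z_n,\qquad t\in[0,1],$$ converges uniformly on $[0,1]$ and with respect to $\|\cdot\|_\alpha$ to an $\alpha$-Hölder continuous function, and the process $W$ (set equal to $0$ on the null event where the series does not converge uniformly) is an $H$-valued $Q$-Wiener process: $W_0=0$, $W$ has continuous trajectories and independent increments, and $W_t-W_s\sim\mathcal N(0,(t-s)Q)$ for $0\le s\le t\le 1$. Moreover, almost surely $W\in C^0_\alpha([0,1];H)$, $T^H_\alpha(W)=(c_n(\alpha)Z_n)_{n\ge 0}$, and this sequence converges to $0$ in $H$. -/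

import Mathlib

open MeasureTheory ProbabilityTheory Filter Topology
open scoped NNReal ENNReal InnerProductSpace unitInterval

noncomputable section

namespace SchauderWiener

/-- For `n ≥ 1`, the level `k` in the unique decomposition `n = 2 ^ k + l`, `0 ≤ l ≤ 2 ^ k - 1`. -/
def level (n : ℕ) : ℕ := Nat.log 2 n

/-- For `n ≥ 1`, the position `l` in the unique decomposition `n = 2 ^ k + l`,
`0 ≤ l ≤ 2 ^ k - 1`. -/
def shift (n : ℕ) : ℕ := n - 2 ^ level n

theorem level_shift {n : ℕ} (hn : n ≠ 0) :
    n = 2 ^ level n + shift n ∧ shift n < 2 ^ level n := by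
  have h1 : 2 ^ level n ≤ n := Nat.pow_log_le_self 2 hn
  have h2 : n < 2 ^ (level n + 1) := Nat.lt_pow_succ_log_self (by norm_num) n
  rw [pow_succ] at h2
  unfold shift
  omega

/-- Left end point `2 l / 2 ^ (k + 1)` of the support of the `n`-th Haar function. -/
def leftPt (n : ℕ) : ℝ := (2 * shift n : ℝ) / 2 ^ (level n + 1)

/-- Mid point `(2 l + 1) / 2 ^ (k + 1)` of the support of the `n`-th Haar function. -/
def midPt (n : ℕ) : ℝ := (2 * shift n + 1 : ℝ) / 2 ^ (level n + 1)

/-- Right end point `(2 l + 2) / 2 ^ (k + 1)` of the support of the `n`-th Haar function. -/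
def rightPt (n : ℕ) : ℝ := (2 * shift n + 2 : ℝ) / 2 ^ (level n + 1)

/-- The Haar functions `χ_n`. -/
def haar (n : ℕ) (t : ℝ) : ℝ :=
  if n = 0 then 1
  else if leftPt n ≤ t ∧ t < midPt n then √(2 ^ level n)
  else if midPt n ≤ t ∧ t ≤ rightPt n then -√(2 ^ level n)
  else 0

/-- The Schauder functions `φ_n`, the primitives of the Haar functions. -/
def schauder (n : ℕ) (t : I) : ℝ := ∫ s in (0 : ℝ)..t, haar n s

/-- The weights `c_n(α)`: `c_0(α) = 1` and `c_n(α) = 2 ^ (k (α - 1/2) + α - 1)` for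
`n = 2 ^ k + l`. -/
def weight (α : ℝ) (n : ℕ) : ℝ :=
  if n = 0 then 1 else (2 : ℝ) ^ ((level n : ℝ) * (α - 1 / 2) + α - 1)

section Hilbert

variable {H : Type*} [NormedAddCommGroup H] [InnerProductSpace ℝ H]

/-- `∫_{[0,1]} χ_n dF`, i.e. `F(1) - F(0)` for `n = 0` and
`√(2 ^ k) (2 F(mid) - F(right) - F(left))` for `n = 2 ^ k + l`. The points all lie in `[0, 1]`, so
the projection onto `[0, 1]` only serves typing. -/
def haarCoeff (F : I → H) (n : ℕ) : H :=
  if n = 0 then F 1 - F 0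
  else √(2 ^ level n) •
    ((2 : ℝ) • F (Set.projIcc 0 1 zero_le_one (midPt n))
      - F (Set.projIcc 0 1 zero_le_one (rightPt n))
      - F (Set.projIcc 0 1 zero_le_one (leftPt n)))

/-- The Ciesielski map `T_α^H F = (c_n(α) ∫ χ_n dF)_n`. -/
def ciesielski (α : ℝ) (F : I → H) (n : ℕ) : H := weight α n • haarCoeff F n

/-- The space `C_α^0([0,1]; H)` of functions with `F(0) = 0` and
`sup_{0 < |t - s| < δ} ‖F(t) - F(s)‖ / |t - s| ^ α → 0` as `δ → 0`. -/
def IsLittleHolder (α : ℝ) (F : I → H) : Prop :=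
  F 0 = 0 ∧
  Tendsto (fun δ : ℝ => ⨆ (s : I) (t : I) (_ : t ≠ s) (_ : |(t : ℝ) - s| < δ),
    ENNReal.ofReal (‖F t - F s‖ / |(t : ℝ) - s| ^ α)) (𝓝[>] 0) (𝓝 0)

/-- The partial sums `t ↦ ∑_{n < N} φ_n(t) z_n` of the Schauder series. -/
def schauderPartialSum (z : ℕ → H) (N : ℕ) (t : I) : H :=
  ∑ n ∈ Finset.range N, schauder n t • z n

open Classical in
/-- The sum `t ↦ ∑_n φ_n(t) z_n` of the Schauder series, i.e. the limit of the partial sums, if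
these converge uniformly on `[0, 1]`, and the zero function otherwise. -/
def schauderSum (z : ℕ → H) : I → H :=
  if h : ∃ F : I → H, TendstoUniformly (schauderPartialSum z) F atTop then h.choose else 0

theorem schauderSum_eq {z : ℕ → H} {F : I → H}
    (hF : TendstoUniformly (schauderPartialSum z) F atTop) : schauderSum z = F := by
  have h : ∃ F : I → H, TendstoUniformly (schauderPartialSum z) F atTop := ⟨F, hF⟩
  rw [schauderSum, dif_pos h]
  funext t
  exact tendsto_nhds_unique (h.choose_spec.tendsto_at t) (hF.tendsto_at t)

/-- A positive self-adjoint operator `Q` is trace class: `∑_k ⟪Q e_k, e_k⟫ < ∞` for every complete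
orthonormal system `(e_k)`. (In a separable space these are countable, so that index types in
`Type` suffice.) -/
def HasFiniteTrace (Q : H →L[ℝ] H) : Prop :=
  ∀ (ι : Type) (e : HilbertBasis ι ℝ H), Summable fun k => ⟪Q (e k), e k⟫_ℝ

variable [MeasurableSpace H]

/-- `μ` is the Gaussian law `𝒩(m, Q)` on `H`: its characteristic function is
`h ↦ exp (i ⟪h, m⟫ - ⟪Q h, h⟫ / 2)`. -/
def IsGaussianLaw (μ : Measure H) (m : H) (Q : H →L[ℝ] H) : Prop :=
  ∀ h : H, charFun μ h =
    Complex.exp (Complex.I * (⟪h, m⟫_ℝ : ℂ) - (1 / 2 : ℂ) * (⟪Q h, h⟫_ℝ : ℂ))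

/-- `W` is an `H`-valued `Q`-Wiener process on `[0, 1]`. -/
structure IsQWiener {Ω : Type*} [MeasurableSpace Ω] (Q : H →L[ℝ] H) (W : I → Ω → H)
    (P : Measure Ω) : Prop where
  measurable : ∀ t, Measurable (W t)
  zero : ∀ ω, W 0 ω = 0
  continuous : ∀ ω, Continuous fun t => W t ω
  indep : HasIndepIncrements W P
  law : ∀ s t : I, s ≤ t →
    IsGaussianLaw (P.map fun ω => W t ω - W s ω) 0 (((t : ℝ) - s) • Q)

end Hilbert

end SchauderWiener

end

/-!
The convergence of the series rests on one deterministic estimate for the Schauder functions of a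
level `k`, namely `∑_{2^k ≤ n < 2^(k+1)} |φ_n(t) - φ_n(s)| ≤ 2 · 2^(k(β - 1/2)) |t - s|^β`
for `0 ≤ β ≤ 1` (`sum_abs_schauder_sub_le_rpow`). It interpolates between a Lipschitz bound, which is
a telescoping sum since the supports of a level tile `[0, 1]`, and a sup bound. Consequently, if
`‖z n‖ ≤ K ρ ^ level n` with `ρ 2^(β - 1/2) < 1`, the series `∑ φ_n z_n` converges absolutely, with
geometrically small tails in the `β`-Hölder norm (`norm_schauderPartialSum_sub_tsum_le`). The Haar
coefficients of the sum are the `z n` by biorthogonality (`haarCoeff_schauder`,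
`haarCoeff_eq_of_tendsto`). A limit that is Hölder of some order `β > α` is little Hölder of order
`α` (`isLittleHolder_of_memHolder`).

The growth condition holds almost surely for every `ρ > 1`: a Gaussian law on a Hilbert space has
moments of all orders by Fernique's theorem, and Markov's inequality and the Borel-Cantelli lemma
apply (`ae_exists_norm_le_mul_pow_level`). For given `α < 1/2` there is room to choose
`β ∈ (α, 1/2)` and then `ρ > 1` with `ρ 2^(β - 1/2) < 1`.

That the sum is a `Q`-Wiener process is read off characteristic functions. Independence of the `Z n`
and dominated convergence give the joint characteristic function of finitely many increments in
terms of the sums `∑_n (φ_n(t) - φ_n(s)) (φ_n(v) - φ_n(u))` (`integral_cexp_sum_inner_of_tendsto`).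
By `∑_n φ_n(s) φ_n(t) = min s t` (`hasSum_schauder_mul_schauder`) this sum is the length of
`[s, t] ∩ [u, v]`. The completeness of the Haar system behind that identity takes an elementary
form: a continuous function vanishing at `0` whose Haar coefficients all vanish is zero at every
dyadic point (`eq_zero_of_haarCoeff_eq_zero`).
-/

namespace SchauderWiener

/-! ### Schauder functions of one level -/

theorem leftPt_nonneg (n : ℕ) : 0 ≤ leftPt n := by
  unfold leftPt; positivity

theorem leftPt_le_midPt (n : ℕ) : leftPt n ≤ midPt n := by
  unfold leftPt midPt; gcongr; linarith

theorem midPt_le_rightPt (n : ℕ) : midPt n ≤ rightPt n := by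
  unfold rightPt midPt; gcongr; linarith

theorem two_mul_midPt (n : ℕ) : 2 * midPt n = leftPt n + rightPt n := by
  unfold rightPt midPt leftPt; ring

theorem level_two_pow_add {k l : ℕ} (hl : l < 2 ^ k) : level (2 ^ k + l) = k := by
  unfold level
  exact Nat.log_eq_of_pow_le_of_lt_pow (by omega) (by rw [pow_succ]; omega)

theorem shift_two_pow_add {k l : ℕ} (hl : l < 2 ^ k) : shift (2 ^ k + l) = l := by
  simp [shift, level_two_pow_add hl]

theorem leftPt_eq (n : ℕ) : leftPt n = shift n / 2 ^ level n := by
  unfold leftPt; rw [pow_succ]; field_simp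

theorem rightPt_eq (n : ℕ) : rightPt n = (shift n + 1) / 2 ^ level n := by
  unfold rightPt; rw [pow_succ]; field_simp

theorem midPt_eq (n : ℕ) : midPt n = (2 * shift n + 1) / 2 ^ (level n + 1) := rfl

theorem rightPt_le_one {n : ℕ} (hn : n ≠ 0) : rightPt n ≤ 1 := by
  rw [rightPt_eq, div_le_one (by positivity)]
  exact_mod_cast (level_shift hn).2

theorem setIntegral_indicator_one_eq {S : Set ℝ} {a b t : ℝ} (hS : S =ᵐ[volume] Set.Ioc a b)
    (ha : 0 ≤ a) (hab : a ≤ b) (ht : 0 ≤ t) (hSm : MeasurableSet S) :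
    ∫ s in (0 : ℝ)..t, S.indicator (fun _ => (1 : ℝ)) s = min t b - min t a := by
  rw [intervalIntegral.integral_of_le ht, setIntegral_indicator hSm]
  rw [setIntegral_congr_set (t := Set.Ioc 0 t ∩ Set.Ioc a b) ((ae_eq_refl _).inter hS)]
  simp only [integral_const, smul_eq_mul, mul_one, MeasurableSet.univ, measureReal_restrict_apply,
    Set.univ_inter, Set.Ioc_inter_Ioc]
  rw [Real.volume_real_Ioc]
  grind

/-- The Schauder functions as second differences of `min`: the Haar coefficients of the function
`s ↦ min t s` are the values `φ_n(t)`. -/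
theorem schauder_eq {n : ℕ} (hn : n ≠ 0) (t : I) :
    schauder n t = √(2 ^ level n) *
      (2 * min (t : ℝ) (midPt n) - min (t : ℝ) (rightPt n) - min (t : ℝ) (leftPt n)) := by
  have h1 : ∀ s, haar n s = √(2 ^ level n) *
      ((Set.Ico (leftPt n) (midPt n)).indicator (fun _ => (1 : ℝ)) s -
        (Set.Icc (midPt n) (rightPt n)).indicator (fun _ => (1 : ℝ)) s) := by
    intro s
    simp only [haar, hn, if_false, Set.indicator, Set.mem_Ico, Set.mem_Icc]
    split_ifs <;> grind
  have hint : ∀ S : Set ℝ, MeasurableSet S →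
      IntervalIntegrable (S.indicator (fun _ => (1 : ℝ))) volume 0 (t : ℝ) := by
    intro S hS
    rw [intervalIntegrable_iff]
    exact (integrableOn_const (by simp)).integrable.indicator hS
  have ht := t.2.1
  unfold schauder
  simp_rw [h1]
  rw [intervalIntegral.integral_const_mul, intervalIntegral.integral_sub
    (hint _ measurableSet_Ico) (hint _ measurableSet_Icc),
    setIntegral_indicator_one_eq Ico_ae_eq_Ioc (leftPt_nonneg n) (leftPt_le_midPt n) ht
      measurableSet_Ico,
    setIntegral_indicator_one_eq Ioc_ae_eq_Icc.symm
      ((leftPt_nonneg n).trans (leftPt_le_midPt n)) (midPt_le_rightPt n) ht measurableSet_Icc]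
  ring

theorem schauder_zero_left (t : I) : schauder 0 t = t := by
  simp [schauder, haar]

theorem schauder_apply_zero (n : ℕ) : schauder n 0 = 0 := by
  simp [schauder]

theorem continuous_schauder (n : ℕ) : Continuous (schauder n) := by
  rcases eq_or_ne n 0 with rfl | hn
  · simpa only [funext schauder_zero_left] using continuous_subtype_val
  · rw [funext (schauder_eq hn)]
    fun_prop

theorem schauder_eq_zero_of_notMem {n : ℕ} (hn : n ≠ 0) {t : I}
    (ht : (t : ℝ) ≤ leftPt n ∨ rightPt n ≤ t) : schauder n t = 0 := by
  have := leftPt_le_midPt n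
  have := midPt_le_rightPt n
  have := two_mul_midPt n
  rw [schauder_eq hn]
  have : 2 * min (t : ℝ) (midPt n) - min (t : ℝ) (rightPt n) - min (t : ℝ) (leftPt n) = 0 := by
    grind
  rw [this, mul_zero]

/-- Schauder functions of level `k` vanish on the grid of mesh `2 ^ (-k)`. -/
theorem schauder_eq_zero_of_mul_two_pow_eq {n : ℕ} (hn : n ≠ 0) {t : I} {j : ℕ}
    (ht : (t : ℝ) * 2 ^ level n = j) : schauder n t = 0 := by
  have hk : (0 : ℝ) < 2 ^ level n := by positivity
  refine schauder_eq_zero_of_notMem hn ?_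
  rw [leftPt_eq, rightPt_eq, le_div_iff₀ hk, div_le_iff₀ hk, ht]
  exact_mod_cast le_or_gt j (shift n)

/-- The slope of `φ_n` is `±√(2 ^ k)` on its support and `0` elsewhere; the second factor is the
length of the part of `[s, t]` that lies in the support. -/
theorem abs_schauder_sub_le {n : ℕ} (hn : n ≠ 0) {s t : I} (hst : s ≤ t) :
    |schauder n t - schauder n s| ≤ √(2 ^ level n) *
      ((min (t : ℝ) (rightPt n) - min (t : ℝ) (leftPt n)) -
        (min (s : ℝ) (rightPt n) - min (s : ℝ) (leftPt n))) := by
  have := leftPt_le_midPt n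
  have := midPt_le_rightPt n
  have hst' : (s : ℝ) ≤ t := hst
  rw [schauder_eq hn, schauder_eq hn, ← mul_sub, abs_mul, abs_of_nonneg (Real.sqrt_nonneg _)]
  gcongr
  have h1 : min (s : ℝ) (midPt n) - min (s : ℝ) (leftPt n)
      ≤ min (t : ℝ) (midPt n) - min (t : ℝ) (leftPt n) := by grind
  have h2 : min (s : ℝ) (rightPt n) - min (s : ℝ) (midPt n)
      ≤ min (t : ℝ) (rightPt n) - min (t : ℝ) (midPt n) := by grind
  rw [abs_le]
  constructor <;> linarith

theorem sum_Ico_two_pow {M : Type*} [AddCommMonoid M] (k : ℕ) (f : ℕ → M) :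
    ∑ n ∈ Finset.Ico (2 ^ k) (2 ^ (k + 1)), f n = ∑ l ∈ Finset.range (2 ^ k), f (2 ^ k + l) := by
  rw [Finset.sum_Ico_eq_sum_range, pow_succ, mul_two, Nat.add_sub_cancel]

/-- The supports of the Schauder functions of one level tile `[0, 1]`. -/
theorem sum_min_rightPt_sub_min_leftPt (k : ℕ) (t : I) :
    ∑ n ∈ Finset.Ico (2 ^ k) (2 ^ (k + 1)),
      (min (t : ℝ) (rightPt n) - min (t : ℝ) (leftPt n)) = t := by
  rw [sum_Ico_two_pow]
  have h : ∀ l ∈ Finset.range (2 ^ k),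
      min (t : ℝ) (rightPt (2 ^ k + l)) - min (t : ℝ) (leftPt (2 ^ k + l)) =
        (fun l : ℕ => min (t : ℝ) (l / 2 ^ k)) (l + 1) -
          (fun l : ℕ => min (t : ℝ) (l / 2 ^ k)) l := by
    intro l hl
    have hl := Finset.mem_range.1 hl
    simp [leftPt_eq, rightPt_eq, level_two_pow_add hl, shift_two_pow_add hl]
  rw [Finset.sum_congr rfl h, Finset.sum_range_sub (fun l : ℕ => min (t : ℝ) (l / 2 ^ k))]
  have := t.2.1
  have := t.2.2
  simp [*]

theorem ne_zero_and_level_of_mem {k n : ℕ} (hn : n ∈ Finset.Ico (2 ^ k) (2 ^ (k + 1))) :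
    n ≠ 0 ∧ level n = k := by
  rw [Finset.mem_Ico] at hn
  have : 0 < 2 ^ k := by positivity
  exact ⟨by omega, Nat.log_eq_of_pow_le_of_lt_pow hn.1 hn.2⟩

theorem sum_abs_schauder_sub_le_of_le (k : ℕ) {s t : I} (hst : s ≤ t) :
    ∑ n ∈ Finset.Ico (2 ^ k) (2 ^ (k + 1)), |schauder n t - schauder n s|
      ≤ √(2 ^ k) * (t - s) := by
  calc _ ≤ ∑ n ∈ Finset.Ico (2 ^ k) (2 ^ (k + 1)), √(2 ^ k) *
        ((min (t : ℝ) (rightPt n) - min (t : ℝ) (leftPt n)) -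
          (min (s : ℝ) (rightPt n) - min (s : ℝ) (leftPt n))) := by
        refine Finset.sum_le_sum fun n hn => ?_
        obtain ⟨h0, h1⟩ := ne_zero_and_level_of_mem hn
        have := abs_schauder_sub_le h0 hst
        rwa [h1] at this
    _ = _ := by
        rw [← Finset.mul_sum, Finset.sum_sub_distrib, sum_min_rightPt_sub_min_leftPt,
          sum_min_rightPt_sub_min_leftPt]

theorem sum_abs_schauder_sub_le (k : ℕ) (s t : I) :
    ∑ n ∈ Finset.Ico (2 ^ k) (2 ^ (k + 1)), |schauder n t - schauder n s|
      ≤ √(2 ^ k) * |(t : ℝ) - s| := by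
  rcases le_total s t with h | h
  · rw [abs_of_nonneg (sub_nonneg.2 (show (s : ℝ) ≤ t from h))]
    exact sum_abs_schauder_sub_le_of_le k h
  · rw [abs_sub_comm, abs_of_nonneg (sub_nonneg.2 (show (t : ℝ) ≤ s from h))]
    simp_rw [abs_sub_comm (schauder _ t)]
    exact sum_abs_schauder_sub_le_of_le k h

/-- The sup bound follows from the Lipschitz bound, because all Schauder functions of level `k`
vanish at the multiples of `2 ^ (-k)`. -/
theorem sum_abs_schauder_le (k : ℕ) (t : I) :
    ∑ n ∈ Finset.Ico (2 ^ k) (2 ^ (k + 1)), |schauder n t| ≤ √(2 ^ k) * (2 ^ k)⁻¹ := by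
  have hk : (0 : ℝ) < 2 ^ k := by positivity
  set j : ℕ := ⌊(t : ℝ) * 2 ^ k⌋₊ with hj
  have hj1 : (j : ℝ) ≤ t * 2 ^ k := Nat.floor_le (mul_nonneg t.2.1 hk.le)
  have hj2 : (t : ℝ) * 2 ^ k < j + 1 := Nat.lt_floor_add_one _
  have hst : (j : ℝ) / 2 ^ k ≤ t := by rwa [div_le_iff₀ hk]
  let s : I := ⟨j / 2 ^ k, by positivity, hst.trans t.2.2⟩
  have hs : ∀ n ∈ Finset.Ico (2 ^ k) (2 ^ (k + 1)), |schauder n t| =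
      |schauder n t - schauder n s| := by
    intro n hn
    obtain ⟨h0, h1⟩ := ne_zero_and_level_of_mem hn
    rw [schauder_eq_zero_of_mul_two_pow_eq (t := s) (j := j) h0, sub_zero]
    rw [h1]
    exact div_mul_cancel₀ _ hk.ne'
  rw [Finset.sum_congr rfl hs]
  refine (sum_abs_schauder_sub_le_of_le k (show s ≤ t from hst)).trans ?_
  gcongr
  change (t : ℝ) - j / 2 ^ k ≤ _
  rw [sub_le_iff_le_add, inv_eq_one_div, ← add_div, le_div_iff₀ hk]
  linarith

/-- Interpolation between the sup bound and the Lipschitz bound of a level. -/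
theorem sum_abs_schauder_sub_le_rpow {β : ℝ} (h0 : 0 ≤ β) (h1 : β ≤ 1) (k : ℕ) (s t : I) :
    ∑ n ∈ Finset.Ico (2 ^ k) (2 ^ (k + 1)), |schauder n t - schauder n s|
      ≤ 2 * ((2 : ℝ) ^ (β - 1 / 2)) ^ k * |(t : ℝ) - s| ^ β := by
  have hk : (0 : ℝ) < 2 ^ k := by positivity
  have hx := abs_nonneg ((t : ℝ) - s)
  set x := |(t : ℝ) - s| with hxdef
  have e1 : 2 * ((2 : ℝ) ^ (β - 1 / 2)) ^ k * x ^ β = 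
      2 * (√(2 ^ k) * (2 ^ k)⁻¹) * (2 ^ k * x) ^ β := by
    rw [Real.mul_rpow hk.le hx, Real.sqrt_eq_rpow, ← Real.rpow_natCast, ← Real.rpow_mul two_pos.le,
      ← Real.rpow_natCast 2 k, ← Real.rpow_mul two_pos.le, ← Real.rpow_mul two_pos.le,
      ← Real.rpow_neg two_pos.le, ← Real.rpow_add two_pos]
    rw [mul_assoc 2 _ ((2 : ℝ) ^ (k * β) * x ^ β), ← mul_assoc _ _ (x ^ β),
      ← Real.rpow_add two_pos]
    ring_nf
  rw [e1]
  rcases le_or_gt 1 (2 ^ k * x) with h | h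
  · have hp : 1 ≤ (2 ^ k * x) ^ β := Real.one_le_rpow h h0
    calc _ ≤ ∑ n ∈ Finset.Ico (2 ^ k) (2 ^ (k + 1)), (|schauder n t| + |schauder n s|) :=
          Finset.sum_le_sum fun n _ => abs_sub _ _
      _ ≤ 2 * (√(2 ^ k) * (2 ^ k)⁻¹) := by
          rw [Finset.sum_add_distrib, two_mul]
          exact add_le_add (sum_abs_schauder_le k t) (sum_abs_schauder_le k s)
      _ ≤ _ := le_mul_of_one_le_right (by positivity) hp
  · have hp : 2 ^ k * x ≤ (2 ^ k * x) ^ β := by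
      conv_lhs => rw [← Real.rpow_one (2 ^ k * x)]
      exact Real.rpow_le_rpow_of_exponent_ge' (by positivity) h.le h0 h1
    calc _ ≤ √(2 ^ k) * x := sum_abs_schauder_sub_le k s t
      _ = (√(2 ^ k) * (2 ^ k)⁻¹) * (2 ^ k * x) := by field_simp
      _ ≤ (√(2 ^ k) * (2 ^ k)⁻¹) * (2 ^ k * x) ^ β := by gcongr
      _ ≤ 2 * (√(2 ^ k) * (2 ^ k)⁻¹) * (2 ^ k * x) ^ β := by
          rw [mul_assoc 2]
          exact le_mul_of_one_le_left (by positivity) one_le_two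

/-! ### Convergence of Schauder series in Hölder norms -/

theorem isLittleHolder_of_memHolder {E : Type*} [NormedAddCommGroup E] {α : ℝ} {β : ℝ≥0} (hαβ : α < β)
    {F : I → E} (hF0 : F 0 = 0)
    (hF : MemHolder β F) : IsLittleHolder α F := by
  obtain ⟨C, hC⟩ := hF
  refine ⟨hF0, ?_⟩
  have hlim : Tendsto (fun δ : ℝ => ENNReal.ofReal (C * δ ^ ((β : ℝ) - α))) (𝓝[>] 0) (𝓝 0) := by
    have h : Tendsto (fun δ : ℝ => C * δ ^ ((β : ℝ) - α)) (𝓝 0) (𝓝 (C * 0 ^ ((β : ℝ) - α))) :=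
      ((Real.continuousAt_rpow_const 0 _ (Or.inr (sub_pos.2 hαβ).le)).tendsto).const_mul _
    rw [Real.zero_rpow (sub_pos.2 hαβ).ne', mul_zero] at h
    simpa using ENNReal.tendsto_ofReal (h.mono_left nhdsWithin_le_nhds)
  refine tendsto_of_tendsto_of_tendsto_of_le_of_le tendsto_const_nhds hlim
    (fun _ => zero_le) fun δ => ?_
  refine iSup_le fun s => iSup_le fun t => iSup_le fun hts => iSup_le fun hδ => ?_
  refine ENNReal.ofReal_le_ofReal ?_
  have hpos : 0 < |(t : ℝ) - s| := abs_pos.2 (sub_ne_zero.2 fun h => hts (Subtype.ext h))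
  have h := hC.dist_le t s
  rw [dist_eq_norm, Subtype.dist_eq, Real.dist_eq] at h
  rw [div_le_iff₀ (by positivity)]
  calc ‖F t - F s‖ ≤ C * |(t : ℝ) - s| ^ (β : ℝ) := h
    _ = C * |(t : ℝ) - s| ^ ((β : ℝ) - α) * |(t : ℝ) - s| ^ α := by
        rw [mul_assoc, ← Real.rpow_add hpos, sub_add_cancel]
    _ ≤ C * δ ^ ((β : ℝ) - α) * |(t : ℝ) - s| ^ α := by
        have := (sub_pos.2 hαβ).le
        gcongr

section Increments

variable {E : Type*} [NormedAddCommGroup E]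

theorem sum_Ico_two_pow_abs_schauder_sub_mul_norm_le {β ρ K : ℝ} (h0 : 0 ≤ β) (h1 : β ≤ 1)
    (hρ : 0 ≤ ρ) (hq : ρ * 2 ^ (β - 1 / 2) < 1) {z : ℕ → E}
    (hz : ∀ n, ‖z n‖ ≤ K * ρ ^ level n) {a b : ℕ} (hab : a ≤ b) (s t : I) :
    ∑ n ∈ Finset.Ico (2 ^ a) (2 ^ b), |schauder n t - schauder n s| * ‖z n‖
      ≤ 2 * K / (1 - ρ * 2 ^ (β - 1 / 2)) * (ρ * 2 ^ (β - 1 / 2)) ^ a * |(t : ℝ) - s| ^ β := by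
  have hK : 0 ≤ K := by simpa [level] using (norm_nonneg _).trans (hz 0)
  set q : ℝ := ρ * 2 ^ (β - 1 / 2) with hqdef
  have hq0 : 0 ≤ q := by positivity
  have hblocks : ∑ n ∈ Finset.Ico (2 ^ a) (2 ^ b), |schauder n t - schauder n s| * ‖z n‖
      ≤ ∑ k ∈ Finset.Ico a b, 2 * K * q ^ k * |(t : ℝ) - s| ^ β := by
    induction b, hab using Nat.le_induction with
    | base => simp
    | succ b hab ih =>
      rw [Finset.sum_Ico_succ_top hab, ← Finset.sum_Ico_consecutive _
        (Nat.pow_le_pow_right two_pos hab) (Nat.pow_le_pow_right two_pos b.le_succ)]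
      refine add_le_add ih ?_
      calc _ ≤ ∑ n ∈ Finset.Ico (2 ^ b) (2 ^ (b + 1)),
            |schauder n t - schauder n s| * (K * ρ ^ b) := by
            refine Finset.sum_le_sum fun n hn => ?_
            gcongr
            simpa [(ne_zero_and_level_of_mem hn).2] using hz n
        _ ≤ (2 * ((2 : ℝ) ^ (β - 1 / 2)) ^ b * |(t : ℝ) - s| ^ β) * (K * ρ ^ b) := by
            rw [← Finset.sum_mul]
            gcongr
            exact sum_abs_schauder_sub_le_rpow h0 h1 b s t
        _ = _ := by rw [hqdef, mul_pow]; ring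
  -- The levels `a ≤ k < b` contribute a geometric sum of ratio `q`.
  refine hblocks.trans ?_
  rw [← Finset.sum_mul, ← Finset.mul_sum]
  refine mul_le_mul_of_nonneg_right ?_ (by positivity)
  have hgeom : ∑ k ∈ Finset.Ico a b, q ^ k ≤ q ^ a / (1 - q) := geom_sum_Ico_le_of_lt_one hq0 hq
  calc 2 * K * ∑ k ∈ Finset.Ico a b, q ^ k ≤ 2 * K * (q ^ a / (1 - q)) := by gcongr
    _ = _ := by ring

/-- The tail estimate behind all convergence statements: the increments of the Schauder series are
summable, with geometrically small tails, in every Hölder norm of exponent `β` for which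
`ρ 2 ^ (β - 1/2) < 1`. -/
theorem sum_Ico_abs_schauder_sub_mul_norm_le {β ρ K : ℝ} (h0 : 0 ≤ β) (h1 : β ≤ 1)
    (hρ : 0 ≤ ρ) (hq : ρ * 2 ^ (β - 1 / 2) < 1) {z : ℕ → E}
    (hz : ∀ n, ‖z n‖ ≤ K * ρ ^ level n) {N : ℕ} (hN : N ≠ 0) (M : ℕ) (s t : I) :
    ∑ n ∈ Finset.Ico N M, |schauder n t - schauder n s| * ‖z n‖
      ≤ 2 * K / (1 - ρ * 2 ^ (β - 1 / 2)) * (ρ * 2 ^ (β - 1 / 2)) ^ level N *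
        |(t : ℝ) - s| ^ β := by
  refine le_trans ?_ (sum_Ico_two_pow_abs_schauder_sub_mul_norm_le h0 h1 hρ hq hz
    (le_max_left (level N) M) s t)
  refine Finset.sum_le_sum_of_subset_of_nonneg ?_ fun _ _ _ => by positivity
  refine Finset.Ico_subset_Ico (Nat.pow_log_le_self 2 hN) ?_
  exact (Nat.lt_two_pow_self).le.trans (Nat.pow_le_pow_right two_pos (le_max_right _ _))

theorem summable_schauder_sub_mul_norm {β ρ K : ℝ} (h0 : 0 ≤ β) (h1 : β ≤ 1)
    (hρ : 0 ≤ ρ) (hq : ρ * 2 ^ (β - 1 / 2) < 1) {z : ℕ → E}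
    (hz : ∀ n, ‖z n‖ ≤ K * ρ ^ level n) (s t : I) :
    Summable fun n => |schauder n t - schauder n s| * ‖z n‖ := by
  rw [← summable_nat_add_iff 1]
  have h : ∀ M, ∑ n ∈ Finset.range M, |schauder (n + 1) t - schauder (n + 1) s| * ‖z (n + 1)‖ ≤
      2 * K / (1 - ρ * 2 ^ (β - 1 / 2)) * (ρ * 2 ^ (β - 1 / 2)) ^ level 1 *
        |(t : ℝ) - s| ^ β := by
    intro M
    rw [Finset.range_eq_Ico, Finset.sum_Ico_add'
      (fun n => |schauder n t - schauder n s| * ‖z n‖) 0 M 1]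
    exact sum_Ico_abs_schauder_sub_mul_norm_le h0 h1 hρ hq hz (by simp) _ s t
  exact summable_of_sum_range_le (fun n => by positivity) h

end Increments

section Series

variable {H : Type*} [NormedAddCommGroup H] [InnerProductSpace ℝ H]

theorem schauderPartialSum_sub_apply (z : ℕ → H) (N : ℕ) (s t : I) :
    schauderPartialSum z N t - schauderPartialSum z N s =
      ∑ n ∈ Finset.range N, (schauder n t - schauder n s) • z n := by
  simp [schauderPartialSum, ← Finset.sum_sub_distrib, sub_smul]

theorem schauderPartialSum_apply_zero (z : ℕ → H) (N : ℕ) : schauderPartialSum z N 0 = 0 := by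
  simp [schauderPartialSum, schauder_apply_zero]

theorem continuous_schauderPartialSum (z : ℕ → H) (N : ℕ) :
    Continuous (schauderPartialSum z N) :=
  continuous_finsetSum _ fun n _ => (continuous_schauder n).smul continuous_const

theorem tendsto_level_atTop : Tendsto level atTop atTop := by
  refine tendsto_atTop.2 fun k => ?_
  filter_upwards [eventually_ge_atTop (2 ^ k)] with n hn
  exact Nat.le_log_of_pow_le (by norm_num) hn

variable [CompleteSpace H]

theorem tendsto_schauderPartialSum {β ρ K : ℝ} (h0 : 0 ≤ β) (h1 : β ≤ 1)
    (hρ : 0 ≤ ρ) (hq : ρ * 2 ^ (β - 1 / 2) < 1) {z : ℕ → H}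
    (hz : ∀ n, ‖z n‖ ≤ K * ρ ^ level n) (t : I) :
    Tendsto (fun N => schauderPartialSum z N t) atTop (𝓝 (∑' n, schauder n t • z n)) := by
  have h := summable_schauder_sub_mul_norm h0 h1 hρ hq hz 0 t
  simp only [schauder_apply_zero, sub_zero, ← Real.norm_eq_abs, ← norm_smul] at h
  exact h.of_norm.hasSum.tendsto_sum_nat

theorem norm_schauderPartialSum_sub_tsum_le {β ρ K : ℝ} (h0 : 0 ≤ β) (h1 : β ≤ 1)
    (hρ : 0 ≤ ρ) (hq : ρ * 2 ^ (β - 1 / 2) < 1) {z : ℕ → H}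
    (hz : ∀ n, ‖z n‖ ≤ K * ρ ^ level n) {N : ℕ} (hN : N ≠ 0) (s t : I) :
    ‖(schauderPartialSum z N t - ∑' n, schauder n t • z n) -
      (schauderPartialSum z N s - ∑' n, schauder n s • z n)‖
      ≤ 2 * K / (1 - ρ * 2 ^ (β - 1 / 2)) * (ρ * 2 ^ (β - 1 / 2)) ^ level N *
        |(t : ℝ) - s| ^ β := by
  have hlim := (((tendsto_schauderPartialSum h0 h1 hρ hq hz t).const_sub
    (schauderPartialSum z N t)).sub ((tendsto_schauderPartialSum h0 h1 hρ hq hz s).const_sub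
    (schauderPartialSum z N s))).norm
  refine le_of_tendsto hlim ?_
  filter_upwards [eventually_ge_atTop N] with M hM
  have e : schauderPartialSum z N t - schauderPartialSum z M t -
      (schauderPartialSum z N s - schauderPartialSum z M s) =
      -∑ n ∈ Finset.Ico N M, (schauder n t - schauder n s) • z n := by
    rw [Finset.sum_Ico_eq_sub _ hM, ← schauderPartialSum_sub_apply,
      ← schauderPartialSum_sub_apply]
    abel
  rw [e, norm_neg]
  refine (norm_sum_le _ _).trans ?_
  simp_rw [norm_smul, Real.norm_eq_abs]
  exact sum_Ico_abs_schauder_sub_mul_norm_le h0 h1 hρ hq hz hN M s t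

theorem tendsto_const_mul_pow_level {q : ℝ} (hq0 : 0 ≤ q) (hq : q < 1) (C : ℝ) :
    Tendsto (fun N => C * q ^ level N) atTop (𝓝 0) := by
  simpa using
    ((tendsto_pow_atTop_nhds_zero_of_lt_one hq0 hq).comp tendsto_level_atTop).const_mul C

theorem tendstoUniformly_tsum_schauder {β ρ K : ℝ} (h0 : 0 ≤ β) (h1 : β ≤ 1)
    (hρ : 0 ≤ ρ) (hq : ρ * 2 ^ (β - 1 / 2) < 1) {z : ℕ → H}
    (hz : ∀ n, ‖z n‖ ≤ K * ρ ^ level n) :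
    TendstoUniformly (schauderPartialSum z) (fun t => ∑' n, schauder n t • z n) atTop := by
  have hK : 0 ≤ K := by simpa [level] using (norm_nonneg _).trans (hz 0)
  rw [Metric.tendstoUniformly_iff]
  intro ε hε
  have hq0 : 0 ≤ ρ * 2 ^ (β - 1 / 2) := by positivity
  have h1q := sub_pos.2 hq
  have hlim := tendsto_const_mul_pow_level hq0 hq (2 * K / (1 - ρ * 2 ^ (β - 1 / 2)))
  filter_upwards [hlim.eventually_lt_const hε, eventually_ne_atTop 0] with N hN hN0 t
  have h := norm_schauderPartialSum_sub_tsum_le h0 h1 hρ hq hz hN0 0 t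
  simp only [schauderPartialSum_apply_zero, schauder_apply_zero, zero_smul, tsum_zero,
    sub_zero] at h
  rw [dist_comm, dist_eq_norm]
  refine h.trans_lt (lt_of_le_of_lt (mul_le_of_le_one_right (by positivity) ?_) hN)
  refine Real.rpow_le_one (abs_nonneg _) ?_ h0
  simpa [abs_of_nonneg t.2.1] using t.2.2

theorem tendstoUniformly_schauderSum {β ρ K : ℝ} (h0 : 0 ≤ β) (h1 : β ≤ 1)
    (hρ : 0 ≤ ρ) (hq : ρ * 2 ^ (β - 1 / 2) < 1) {z : ℕ → H}
    (hz : ∀ n, ‖z n‖ ≤ K * ρ ^ level n) :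
    TendstoUniformly (schauderPartialSum z) (schauderSum z) atTop := by
  have h := tendstoUniformly_tsum_schauder h0 h1 hρ hq hz
  rwa [← schauderSum_eq h] at h

theorem holderWith_schauderPartialSum_sub_schauderSum {β : ℝ≥0} {ρ K : ℝ} (h1 : β ≤ 1)
    (hρ : 0 ≤ ρ) (hq : ρ * 2 ^ ((β : ℝ) - 1 / 2) < 1) {z : ℕ → H}
    (hz : ∀ n, ‖z n‖ ≤ K * ρ ^ level n) {N : ℕ} (hN : N ≠ 0) :
    HolderWith (Real.toNNReal (2 * K / (1 - ρ * 2 ^ ((β : ℝ) - 1 / 2)) *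
      (ρ * 2 ^ ((β : ℝ) - 1 / 2)) ^ level N)) β
      (fun t => schauderPartialSum z N t - schauderSum z t) := by
  have hK : 0 ≤ K := by simpa [level] using (norm_nonneg _).trans (hz 0)
  have h1q := sub_pos.2 hq
  intro t s
  have h := norm_schauderPartialSum_sub_tsum_le β.2 h1 hρ hq hz hN s t
  rw [schauderSum_eq (tendstoUniformly_tsum_schauder β.2 h1 hρ hq hz)]
  rw [edist_dist, dist_eq_norm, edist_dist, Subtype.dist_eq, Real.dist_eq,
    ENNReal.ofReal_rpow_of_nonneg (abs_nonneg ((t : ℝ) - s)) β.coe_nonneg, ← ENNReal.ofReal,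
    ← ENNReal.ofReal_mul (by positivity)]
  exact ENNReal.ofReal_le_ofReal h

theorem tendsto_eHolderNorm_schauderPartialSum_sub {β : ℝ≥0} {ρ K : ℝ} (h1 : β ≤ 1)
    (hρ : 0 ≤ ρ) (hq : ρ * 2 ^ ((β : ℝ) - 1 / 2) < 1) {z : ℕ → H}
    (hz : ∀ n, ‖z n‖ ≤ K * ρ ^ level n) :
    Tendsto (fun N => eHolderNorm β (fun t => schauderPartialSum z N t - schauderSum z t))
      atTop (𝓝 0) := by
  have hq0 : 0 ≤ ρ * 2 ^ ((β : ℝ) - 1 / 2) := by positivity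
  have hlim := tendsto_const_mul_pow_level hq0 hq (2 * K / (1 - ρ * 2 ^ ((β : ℝ) - 1 / 2)))
  have hlim' := ENNReal.tendsto_ofReal hlim
  rw [ENNReal.ofReal_zero] at hlim'
  refine tendsto_of_tendsto_of_tendsto_of_le_of_le' tendsto_const_nhds hlim'
    (Eventually.of_forall fun _ => zero_le) ?_
  filter_upwards [eventually_ne_atTop 0] with N hN
  exact (holderWith_schauderPartialSum_sub_schauderSum h1 hρ hq hz hN).eHolderNorm_le

theorem memHolder_schauderSum {β : ℝ≥0} {ρ K : ℝ} (h1 : β ≤ 1)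
    (hρ : 0 ≤ ρ) (hq : ρ * 2 ^ ((β : ℝ) - 1 / 2) < 1) {z : ℕ → H}
    (hz : ∀ n, ‖z n‖ ≤ K * ρ ^ level n) : MemHolder β (schauderSum z) := by
  have hlin : MemHolder 1 (schauderPartialSum z 1) := by
    refine ⟨‖z 0‖₊, holderWith_one.2 (LipschitzWith.of_dist_le_mul fun t s => ?_)⟩
    rw [dist_eq_norm, schauderPartialSum_sub_apply]
    simp [schauder_zero_left, norm_smul, Subtype.dist_eq, Real.dist_eq, mul_comm]
  -- The first partial sum is Lipschitz and differs from the limit by a Hölder function.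
  have hneg := (holderWith_schauderPartialSum_sub_schauderSum h1 hρ hq hz
    one_ne_zero).memHolder.smul (c := (-1 : ℝ))
  convert! (hlin.of_le h1).add hneg using 1
  funext t
  simp

end Series

/-! ### Haar coefficients and Parseval's identity -/

theorem coe_projIcc_leftPt {n : ℕ} (hn : n ≠ 0) :
    ((Set.projIcc 0 1 zero_le_one (leftPt n) : I) : ℝ) = leftPt n := by
  rw [Set.projIcc_of_mem zero_le_one ⟨leftPt_nonneg n,
    ((leftPt_le_midPt n).trans (midPt_le_rightPt n)).trans (rightPt_le_one hn)⟩]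

theorem coe_projIcc_midPt {n : ℕ} (hn : n ≠ 0) :
    ((Set.projIcc 0 1 zero_le_one (midPt n) : I) : ℝ) = midPt n := by
  rw [Set.projIcc_of_mem zero_le_one ⟨(leftPt_nonneg n).trans (leftPt_le_midPt n),
    (midPt_le_rightPt n).trans (rightPt_le_one hn)⟩]

theorem coe_projIcc_rightPt {n : ℕ} (hn : n ≠ 0) :
    ((Set.projIcc 0 1 zero_le_one (rightPt n) : I) : ℝ) = rightPt n := by
  rw [Set.projIcc_of_mem zero_le_one ⟨((leftPt_nonneg n).trans (leftPt_le_midPt n)).trans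
    (midPt_le_rightPt n), rightPt_le_one hn⟩]

theorem haarCoeff_min (s : I) (n : ℕ) :
    haarCoeff (fun t : I => min (s : ℝ) t) n = schauder n s := by
  rcases eq_or_ne n 0 with rfl | hn
  · simp [haarCoeff, schauder_zero_left, s.2.1, s.2.2]
  · simp only [haarCoeff, hn, if_false, coe_projIcc_leftPt hn, coe_projIcc_midPt hn,
      coe_projIcc_rightPt hn, schauder_eq hn, smul_eq_mul]

/-- Both sides are the mixed second difference of `min` at the points of `m` and of `n`. -/
theorem haarCoeff_schauder_comm {m n : ℕ} (hm : m ≠ 0) (hn : n ≠ 0) :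
    haarCoeff (schauder m) n = haarCoeff (schauder n) m := by
  simp only [haarCoeff, hn, hm, if_false, coe_projIcc_leftPt, coe_projIcc_midPt,
      coe_projIcc_rightPt, schauder_eq, smul_eq_mul, ne_eq, not_false_eq_true]
  simp only [min_comm (leftPt m), min_comm (midPt m), min_comm (rightPt m)]
  ring

theorem haarCoeff_schauder_self {n : ℕ} (hn : n ≠ 0) : haarCoeff (schauder n) n = 1 := by
  have h1 := leftPt_le_midPt n
  have h2 := midPt_le_rightPt n
  simp only [haarCoeff, hn, if_false, coe_projIcc_leftPt hn, coe_projIcc_midPt hn,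
      coe_projIcc_rightPt hn, schauder_eq hn, smul_eq_mul, min_self]
  rw [min_eq_left h2, min_eq_right h1, min_eq_left (h1.trans h2), min_eq_right h2,
    min_eq_right (h1.trans h2), min_eq_left h1]
  have hs : √(2 ^ level n) * √(2 ^ level n) = 2 ^ level n := Real.mul_self_sqrt (by positivity)
  calc _ = √(2 ^ level n) * √(2 ^ level n) * (rightPt n - leftPt n) := by ring
    _ = 1 := by rw [hs, leftPt_eq, rightPt_eq]; field_simp; ring

/-- Either `φ_m` has the finer level and vanishes at the three points that define the coefficient,
or the levels agree and the supports do not overlap. -/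
theorem haarCoeff_schauder_of_level_le {m n : ℕ} (hm : m ≠ 0) (hn : n ≠ 0) (hmn : m ≠ n)
    (hl : level n ≤ level m) : haarCoeff (schauder m) n = 0 := by
  rcases hl.lt_or_eq with hl | hl
  · obtain ⟨d, hd⟩ := Nat.exists_eq_add_of_lt hl
    have hpow : (2 : ℝ) ^ level m = 2 ^ (level n + 1) * 2 ^ d := by
      rw [hd, ← pow_add]; congr 1; omega
    simp only [haarCoeff, hn, if_false]
    rw [schauder_eq_zero_of_mul_two_pow_eq (j := (2 * shift n + 1) * 2 ^ d) hm,
      schauder_eq_zero_of_mul_two_pow_eq (j := (2 * shift n + 2) * 2 ^ d) hm,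
      schauder_eq_zero_of_mul_two_pow_eq (j := (2 * shift n) * 2 ^ d) hm]
    · simp
    · rw [coe_projIcc_leftPt hn, hpow, leftPt]; push_cast; field_simp
    · rw [coe_projIcc_rightPt hn, hpow, rightPt]; push_cast; field_simp
    · rw [coe_projIcc_midPt hn, hpow, midPt]; push_cast; field_simp
  · have h1 := leftPt_le_midPt n
    have h2 := midPt_le_rightPt n
    have hs : shift m ≠ shift n := by
      intro h
      apply hmn
      rw [(level_shift hm).1, (level_shift hn).1, h, hl]
    have hk : (0 : ℝ) < 2 ^ level m := by positivity
    have hdis : rightPt n ≤ leftPt m ∨ rightPt m ≤ leftPt n := by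
      rw [leftPt_eq, leftPt_eq, rightPt_eq, rightPt_eq, hl, div_le_div_iff_of_pos_right hk,
        div_le_div_iff_of_pos_right hk]
      rcases hs.lt_or_gt with h | h
      · right; exact_mod_cast h
      · left; exact_mod_cast h
    simp only [haarCoeff, hn, if_false]
    rw [schauder_eq_zero_of_notMem hm, schauder_eq_zero_of_notMem hm,
      schauder_eq_zero_of_notMem hm]
    · simp
    · rw [coe_projIcc_leftPt hn]; rcases hdis with h | h <;> [left; right] <;> linarith
    · rw [coe_projIcc_rightPt hn]; rcases hdis with h | h <;> [left; right] <;> linarith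
    · rw [coe_projIcc_midPt hn]; rcases hdis with h | h <;> [left; right] <;> linarith

/-- The Schauder functions and the Haar coefficient functionals are biorthogonal. -/
theorem haarCoeff_schauder (m n : ℕ) : haarCoeff (schauder m) n = if m = n then 1 else 0 := by
  rcases eq_or_ne n 0 with rfl | hn
  · rcases eq_or_ne m 0 with rfl | hm
    · simp [haarCoeff, schauder_zero_left]
    · have h : schauder m 1 = 0 := schauder_eq_zero_of_notMem hm (Or.inr (rightPt_le_one hm))
      simp [haarCoeff, hm, h, schauder_apply_zero]
  · rcases eq_or_ne m 0 with rfl | hm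
    · have h := two_mul_midPt n
      simp [haarCoeff, hn, hn.symm, schauder_zero_left, coe_projIcc_leftPt hn, coe_projIcc_midPt hn,
        coe_projIcc_rightPt hn, h]
    · split_ifs with hmn
      · rw [hmn, haarCoeff_schauder_self hn]
      · rcases le_total (level n) (level m) with hl | hl
        · exact haarCoeff_schauder_of_level_le hm hn hmn hl
        · rw [haarCoeff_schauder_comm hm hn]
          exact haarCoeff_schauder_of_level_le hn hm (Ne.symm hmn) hl

section Coefficients

variable {H : Type*} [NormedAddCommGroup H] [InnerProductSpace ℝ H]

theorem haarCoeff_schauderPartialSum (z : ℕ → H) (N n : ℕ) :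
    haarCoeff (schauderPartialSum z N) n =
      ∑ m ∈ Finset.range N, haarCoeff (schauder m) n • z m := by
  unfold haarCoeff schauderPartialSum
  split_ifs
  · simp [← Finset.sum_sub_distrib, sub_smul]
  · simp only [smul_eq_mul, mul_smul, sub_smul, Finset.smul_sum, Finset.sum_sub_distrib, smul_sub]

theorem haarCoeff_eq_of_tendsto {z : ℕ → H} {F : I → H}
    (hF : ∀ t, Tendsto (fun N => schauderPartialSum z N t) atTop (𝓝 (F t))) (n : ℕ) :
    haarCoeff F n = z n := by
  have h1 : Tendsto (fun N => haarCoeff (schauderPartialSum z N) n) atTop (𝓝 (haarCoeff F n)) := by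
    unfold haarCoeff
    split_ifs
    · exact (hF _).sub (hF _)
    · exact ((((hF _).const_smul _).sub (hF _)).sub (hF _)).const_smul _
  have h2 : Tendsto (fun N => haarCoeff (schauderPartialSum z N) n) atTop (𝓝 (z n)) := by
    refine tendsto_const_nhds.congr' ?_
    filter_upwards [eventually_gt_atTop n] with N hN
    simp [haarCoeff_schauderPartialSum, haarCoeff_schauder, hN]
  exact tendsto_nhds_unique h1 h2

/-- By recursion on the level: a vanishing Haar coefficient makes the value at a midpoint the mean of
the values at the two neighbouring points of the coarser grid. -/
theorem apply_dyadic_eq_zero_of_haarCoeff_eq_zero {F : I → H} (hF0 : F 0 = 0)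
    (hF : ∀ n, haarCoeff F n = 0) (k j : ℕ) (hj : j ≤ 2 ^ k) :
    F (Set.projIcc 0 1 zero_le_one ((j : ℝ) / 2 ^ k)) = 0 := by
  induction k generalizing j with
  | zero =>
    have h1 : F 1 = 0 := by simpa [haarCoeff, hF0] using hF 0
    rcases Nat.le_one_iff_eq_zero_or_eq_one.1 (by simpa using hj) with rfl | rfl
    · simpa using hF0
    · simpa using h1
  | succ k ih =>
    rw [pow_succ] at hj
    rcases Nat.even_or_odd' j with ⟨i, rfl | rfl⟩
    · have e : ((2 * i : ℕ) : ℝ) / 2 ^ (k + 1) = i / 2 ^ k := by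
        rw [pow_succ]; push_cast; field_simp
      rw [e]
      exact ih i (by omega)
    · have hi : i < 2 ^ k := by omega
      have hn : 2 ^ k + i ≠ 0 := by have : 0 < 2 ^ k := by positivity
                                    omega
      have h := hF (2 ^ k + i)
      simp only [haarCoeff, hn, if_false, leftPt_eq, rightPt_eq, midPt_eq, level_two_pow_add hi,
        shift_two_pow_add hi] at h
      have h1 := ih i hi.le
      have h2 := ih (i + 1) hi
      push_cast at h2 ⊢
      rw [h1, h2, sub_zero, sub_zero, smul_smul, smul_eq_zero] at h
      exact h.resolve_left (by positivity)

/-- A continuous function that vanishes at `0` is determined by its Haar coefficients. -/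
theorem eq_zero_of_haarCoeff_eq_zero {F : I → H} (hFc : Continuous F) (hF0 : F 0 = 0)
    (hF : ∀ n, haarCoeff F n = 0) : F = 0 := by
  funext t
  have hlim : Tendsto (fun k : ℕ => (⌊(t : ℝ) * 2 ^ k⌋₊ : ℝ) / 2 ^ k) atTop (𝓝 (t : ℝ)) :=
    (tendsto_nat_floor_mul_div_atTop t.2.1).comp (tendsto_pow_atTop_atTop_of_one_lt one_lt_two)
  have h := (hFc.tendsto _).comp ((continuous_projIcc (h := zero_le_one' ℝ)).tendsto (t : ℝ) |>.comp
    hlim)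
  rw [Set.projIcc_val] at h
  refine tendsto_nhds_unique h (tendsto_const_nhds.congr fun k => ?_)
  refine (apply_dyadic_eq_zero_of_haarCoeff_eq_zero hF0 hF k _ ?_).symm
  refine Nat.floor_le_of_le ?_
  push_cast
  exact mul_le_of_le_one_left (by positivity) t.2.2

end Coefficients

theorem abs_schauder_le_one (n : ℕ) (t : I) : |schauder n t| ≤ 1 := by
  rcases eq_or_ne n 0 with rfl | hn
  · rw [schauder_zero_left, abs_of_nonneg t.2.1]
    exact t.2.2
  · have hmem : n ∈ Finset.Ico (2 ^ level n) (2 ^ (level n + 1)) :=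
      Finset.mem_Ico.2 ⟨Nat.pow_log_le_self 2 hn, Nat.lt_pow_succ_log_self (by norm_num) n⟩
    have h1 : (1 : ℝ) ≤ 2 ^ level n := one_le_pow₀ one_le_two
    calc |schauder n t| ≤ _ :=
          Finset.single_le_sum (f := fun n => |schauder n t|) (fun _ _ => abs_nonneg _) hmem
      _ ≤ √(2 ^ level n) * (2 ^ level n)⁻¹ := sum_abs_schauder_le _ t
      _ ≤ 2 ^ level n * (2 ^ level n)⁻¹ := by
          gcongr
          rw [Real.sqrt_le_left (by positivity)]
          nlinarith
      _ = 1 := mul_inv_cancel₀ (by positivity)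

/-- Parseval's identity `∑ φ_n(s) φ_n(t) = min s t` for the indicators of `[0, s]` and `[0, t]`:
both sides are continuous in `t` and have the same Haar coefficients. -/
theorem hasSum_schauder_mul_schauder (s t : I) :
    HasSum (fun n => schauder n s * schauder n t) (min (s : ℝ) t) := by
  have hq : (1 : ℝ) * 2 ^ ((0 : ℝ) - 1 / 2) < 1 := by
    rw [one_mul]
    exact Real.rpow_lt_one_of_one_lt_of_neg one_lt_two (by norm_num)
  have hz : ∀ n, ‖schauder n s‖ ≤ 1 * 1 ^ level n := by
    simpa using fun n => abs_schauder_le_one n s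
  have hlim := tendsto_schauderPartialSum le_rfl zero_le_one zero_le_one hq hz
  have hcont : Continuous fun t => ∑' n, schauder n t • schauder n s :=
    (tendstoUniformly_tsum_schauder le_rfl zero_le_one zero_le_one hq hz).continuous
      (Frequently.of_forall fun N => continuous_schauderPartialSum _ N)
  have hzero := eq_zero_of_haarCoeff_eq_zero
    (F := fun t => (∑' n, schauder n t • schauder n s) - min (s : ℝ) t) (by fun_prop)
    (by simp [schauder_apply_zero, s.2.1]) fun n => by
      have h1 := haarCoeff_eq_of_tendsto hlim n
      have h2 := haarCoeff_min s n
      have h3 : haarCoeff (fun t => (∑' n, schauder n t • schauder n s) - min (s : ℝ) t) n =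
          haarCoeff (fun t => ∑' n, schauder n t • schauder n s) n -
            haarCoeff (fun t : I => min (s : ℝ) t) n := by
        unfold haarCoeff
        split_ifs
        · ring
        · simp only [smul_eq_mul]; ring
      rw [h3, h1, h2, sub_self]
  have hsum := summable_schauder_sub_mul_norm le_rfl zero_le_one zero_le_one hq hz 0 t
  simp only [schauder_apply_zero, sub_zero, Real.norm_eq_abs, ← abs_mul] at hsum
  have := hsum.of_abs.hasSum
  have ht := congrFun hzero t
  simp only [smul_eq_mul, Pi.zero_apply, sub_eq_zero] at ht
  rw [ht] at this
  simpa only [mul_comm] using this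

theorem hasSum_schauder_sub_mul_schauder_sub (s t u v : I) :
    HasSum (fun n => (schauder n t - schauder n s) * (schauder n v - schauder n u))
      (min (t : ℝ) v - min (t : ℝ) u - min (s : ℝ) v + min (s : ℝ) u) := by
  have h := (((hasSum_schauder_mul_schauder t v).sub (hasSum_schauder_mul_schauder t u)).sub
    (hasSum_schauder_mul_schauder s v)).add (hasSum_schauder_mul_schauder s u)
  convert! h using 2
  ring

/-! ### Measurability of the sum -/

section Measurability

variable {H : Type*} [NormedAddCommGroup H] [InnerProductSpace ℝ H]

theorem continuous_schauderSum (z : ℕ → H) : Continuous (schauderSum z) := by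
  unfold schauderSum
  split_ifs with h
  · exact h.choose_spec.continuous (Frequently.of_forall fun N => continuous_schauderPartialSum z N)
  · exact continuous_const

theorem schauderSum_apply_zero (z : ℕ → H) : schauderSum z 0 = 0 := by
  unfold schauderSum
  split_ifs with h
  · refine tendsto_nhds_unique (h.choose_spec.tendsto_at 0) ?_
    simp [schauderPartialSum_apply_zero]
  · rfl

variable [CompleteSpace H] [TopologicalSpace.SeparableSpace H] [MeasurableSpace H] [BorelSpace H]

/-- Uniform convergence is convergence in the Polish space `C(I, H)`, so that it defines a Borel
set of coefficient sequences. -/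
theorem measurableSet_exists_tendstoUniformly :
    MeasurableSet {z : ℕ → H | ∃ F : I → H, TendstoUniformly (schauderPartialSum z) F atTop} := by
  have : SecondCountableTopology H := UniformSpace.secondCountable_of_separable H
  borelize C(I, H)
  let S : ℕ → (ℕ → H) → C(I, H) := fun N z =>
    ⟨schauderPartialSum z N, continuous_schauderPartialSum z N⟩
  have hS : ∀ N, Continuous (S N) := by
    intro N
    refine ContinuousMap.continuous_of_continuous_uncurry _ ?_
    change Continuous fun p : (ℕ → H) × I => ∑ n ∈ Finset.range N, schauder n p.2 • p.1 n
    refine continuous_finsetSum _ fun n _ => ?_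
    exact ((continuous_schauder n).comp continuous_snd).smul
      ((continuous_apply n).comp continuous_fst)
  have h := measurableSet_exists_tendsto (l := atTop) fun N => (hS N).measurable
  convert! h using 1
  ext z
  refine ⟨fun ⟨F, hF⟩ => ?_, fun ⟨c, hc⟩ => ⟨c, ?_⟩⟩
  · exact ⟨⟨F, hF.continuous (Frequently.of_forall fun N => continuous_schauderPartialSum z N)⟩,
      ContinuousMap.tendsto_iff_tendstoUniformly.2 hF⟩
  · exact ContinuousMap.tendsto_iff_tendstoUniformly.1 hc

theorem measurable_schauderSum (t : I) : Measurable fun z : ℕ → H => schauderSum z t := by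
  have : SecondCountableTopology H := UniformSpace.secondCountable_of_separable H
  let A := {z : ℕ → H | ∃ F : I → H, TendstoUniformly (schauderPartialSum z) F atTop}
  have hm : ∀ N, Measurable (A.indicator fun z => schauderPartialSum z N t) := by
    intro N
    refine Measurable.indicator ?_ measurableSet_exists_tendstoUniformly
    exact Finset.measurable_sum _ fun n _ => (measurable_pi_apply n).const_smul _
  refine measurable_of_tendsto_metrizable hm (tendsto_pi_nhds.2 fun z => ?_)
  by_cases hz : z ∈ A
  · obtain ⟨F, hF⟩ := hz
    simp only [Set.indicator_of_mem (show z ∈ A from ⟨F, hF⟩), schauderSum_eq hF]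
    exact hF.tendsto_at t
  · have h0 : schauderSum z t = 0 := by
      rw [schauderSum, dif_neg (show ¬∃ F, _ from hz)]; rfl
    simp only [Set.indicator_of_notMem hz, h0]
    exact tendsto_const_nhds

end Measurability

/-! ### Growth of identically distributed random vectors -/

section Growth

variable {Ω : Type*} [MeasurableSpace Ω] {P : Measure Ω}

theorem summable_inv_four_pow_level : Summable fun n => ((4 : ℝ) ^ level n)⁻¹ := by
  have h : Summable fun n : ℕ => 4 * (((n + 1 : ℕ) : ℝ) ^ 2)⁻¹ :=
    ((summable_nat_add_iff 1).2 (Real.summable_nat_pow_inv.2 one_lt_two)).mul_left 4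
  refine h.of_nonneg_of_le (fun n => by positivity) fun n => ?_
  have h1 : n + 1 ≤ 2 ^ level n * 2 := by
    rw [← pow_succ]; exact Nat.lt_pow_succ_log_self (by norm_num) n
  have h2 : ((n + 1 : ℕ) : ℝ) ≤ 2 ^ level n * 2 := by exact_mod_cast h1
  rw [← div_eq_mul_inv, inv_eq_one_div, div_le_div_iff₀ (by positivity) (by positivity), one_mul]
  calc ((n + 1 : ℕ) : ℝ) ^ 2 ≤ (2 ^ level n * 2) ^ 2 := by gcongr
    _ = 4 * 4 ^ level n := by
      rw [mul_pow, ← pow_mul, mul_comm (level n), pow_mul]; norm_num; ring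

/-- Identically distributed random vectors with moments of all orders satisfy, almost surely, the
growth condition with any given `ρ > 1`: by Markov's inequality for a moment of order `p` with
`ρ ^ p ≥ 4`, the probabilities of `ρ ^ level n < ‖X n‖` are summable. -/
theorem ae_exists_norm_le_mul_pow_level {E : Type*} [NormedAddCommGroup E] [MeasurableSpace E]
    [BorelSpace E] {X : ℕ → Ω → E} (hX : ∀ n, Measurable (X n))
    (hlaw : ∀ n, P.map (X n) = P.map (X 0))
    (hmom : ∀ p : ℕ, ∫⁻ x, ‖x‖ₑ ^ p ∂P.map (X 0) ≠ ∞) {ρ : ℝ} (hρ : 1 < ρ) :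
    ∀ᵐ ω ∂P, ∃ K : ℝ, ∀ n, ‖X n ω‖ ≤ K * ρ ^ level n := by
  obtain ⟨p, hp⟩ := pow_unbounded_of_one_lt 4 hρ
  have hp0 : p ≠ 0 := by rintro rfl; norm_num at hp
  have hmeas : ∀ n, P {ω | (4 : ℝ≥0∞) ^ level n ≤ ‖X n ω‖ₑ ^ p} ≤
      (∫⁻ x, ‖x‖ₑ ^ p ∂P.map (X 0)) * ENNReal.ofReal ((4 : ℝ) ^ level n)⁻¹ := by
    intro n
    refine (meas_ge_le_lintegral_div ((hX n).enorm.pow_const p).aemeasurable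
      (by positivity) (by finiteness)).trans_eq ?_
    rw [← hlaw n, lintegral_map (by fun_prop) (hX n), div_eq_mul_inv,
      ENNReal.ofReal_inv_of_pos (by positivity), ENNReal.ofReal_pow (by norm_num)]
    simp
  have hsum : ∑' n, P {ω | (4 : ℝ≥0∞) ^ level n ≤ ‖X n ω‖ₑ ^ p} ≠ ∞ := by
    refine ne_top_of_le_ne_top ?_ (ENNReal.tsum_le_tsum hmeas)
    rw [ENNReal.tsum_mul_left]
    exact ENNReal.mul_ne_top (hmom p) summable_inv_four_pow_level.tsum_ofReal_ne_top
  filter_upwards [ae_eventually_notMem hsum] with ω hω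
  obtain ⟨N, hN⟩ := eventually_atTop.1 hω
  have hlarge : ∀ n, N ≤ n → ‖X n ω‖ ≤ ρ ^ level n := by
    intro n hn
    have h := hN n hn
    simp only [not_le] at h
    rw [← ofReal_norm, ← ENNReal.ofReal_pow (norm_nonneg _),
      show (4 : ℝ≥0∞) = ENNReal.ofReal 4 by simp, ← ENNReal.ofReal_pow (by norm_num),
      ENNReal.ofReal_lt_ofReal_iff (by positivity)] at h
    refine (lt_of_pow_lt_pow_left₀ p (by positivity) (h.trans_le ?_)).le
    rw [← pow_mul, mul_comm, pow_mul]
    gcongr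
  refine ⟨1 + ∑ n ∈ Finset.range N, ‖X n ω‖, fun n => ?_⟩
  have hs : 0 ≤ ∑ n ∈ Finset.range N, ‖X n ω‖ := by positivity
  have hpow : 1 ≤ ρ ^ level n := one_le_pow₀ hρ.le
  rcases le_or_gt N n with h | h
  · refine (hlarge n h).trans (le_mul_of_one_le_left (by positivity) (by linarith))
  · have := Finset.single_le_sum (f := fun n => ‖X n ω‖) (fun _ _ => norm_nonneg _)
      (Finset.mem_range.2 h)
    refine le_trans ?_ (le_mul_of_one_le_right (by positivity) hpow)
    linarith

end Growth

/-! ### Gaussian laws and joint characteristic functions -/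

section Gaussian

variable {H : Type*} [NormedAddCommGroup H] [InnerProductSpace ℝ H] [CompleteSpace H]
  [TopologicalSpace.SeparableSpace H] [MeasurableSpace H] [BorelSpace H]

theorem IsGaussianLaw.isGaussian {μ : Measure H} [IsFiniteMeasure μ] {m : H} {Q : H →L[ℝ] H}
    (hQ : Q.IsPositive) (hμ : IsGaussianLaw μ m Q) : IsGaussian μ := by
  have : SecondCountableTopology H := UniformSpace.secondCountable_of_separable H
  refine isGaussian_iff_gaussian_charFun.2 ⟨m, (innerSL ℝ).comp Q, ?_, fun h => ?_⟩
  · refine ⟨⟨fun x y => ?_⟩, ⟨fun x => ?_⟩⟩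
    · simpa using (hQ.isSymmetric x y).trans (real_inner_comm _ _)
    · simpa using hQ.inner_nonneg_left x
  · rw [hμ h]
    congr 1
    simp
    ring

/-- By Fernique's theorem a Gaussian law has moments of all orders. -/
theorem IsGaussianLaw.lintegral_enorm_pow_ne_top {μ : Measure H} [IsFiniteMeasure μ] {m : H}
    {Q : H →L[ℝ] H} (hQ : Q.IsPositive) (hμ : IsGaussianLaw μ m Q) (p : ℕ) :
    ∫⁻ x, ‖x‖ₑ ^ p ∂μ ≠ ∞ := by
  have : SecondCountableTopology H := UniformSpace.secondCountable_of_separable H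
  have := hμ.isGaussian hQ
  rcases eq_or_ne p 0 with rfl | hp
  · simp
  · have h := (IsGaussian.memLp_id μ p (by simp)).2
    rw [eLpNorm_lt_top_iff_lintegral_rpow_enorm_lt_top (by simpa) (by simp)] at h
    simpa using h.ne

theorem IsGaussianLaw.eq {μ ν : Measure H} [IsFiniteMeasure μ] [IsFiniteMeasure ν] {m : H}
    {Q : H →L[ℝ] H} (hμ : IsGaussianLaw μ m Q) (hν : IsGaussianLaw ν m Q) : μ = ν := by
  have : SecondCountableTopology H := UniformSpace.secondCountable_of_separable H
  exact Measure.ext_of_charFun (funext fun h => (hμ h).trans (hν h).symm)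

variable {Ω : Type*} [MeasurableSpace Ω] {P : Measure Ω}

theorem integral_cexp_sum_inner {Q : H →L[ℝ] H} {Z : ℕ → Ω → H} (hZm : ∀ n, Measurable (Z n))
    (hZi : iIndepFun Z P) (hZ : ∀ n, IsGaussianLaw (P.map (Z n)) 0 Q) (g : ℕ → H) (N : ℕ) :
    ∫ ω, Complex.exp (((∑ n ∈ Finset.range N, ⟪Z n ω, g n⟫_ℝ : ℝ) : ℂ) * Complex.I) ∂P =
      Complex.exp (-(1 / 2) * ((∑ n ∈ Finset.range N, ⟪Q (g n), g n⟫_ℝ : ℝ) : ℂ)) := by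
  have hYm : ∀ n, Measurable fun ω => ⟪Z n ω, g n⟫_ℝ := fun n =>
    (continuous_id.inner continuous_const).measurable.comp (hZm n)
  have hYi : iIndepFun (fun n ω => ⟪Z n ω, g n⟫_ℝ) P :=
    hZi.comp (fun n x => ⟪x, g n⟫_ℝ) fun n => (continuous_id.inner continuous_const).measurable
  have h := congrFun (iIndepFun.charFun_map_fun_finsetSum_eq_prod (s := Finset.range N)
    (fun n _ => (hYm n).aemeasurable) (hYi.restrict _)) 1
  rw [charFun_apply_real, integral_map (by fun_prop) (by fun_prop), Finset.prod_apply] at h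
  have h1 : ∀ n, charFun (P.map fun ω => ⟪Z n ω, g n⟫_ℝ) 1 =
      Complex.exp (-(1 / 2) * (⟪Q (g n), g n⟫_ℝ : ℂ)) := by
    intro n
    have h2 := hZ n (g n)
    rw [charFun_apply, integral_map (hZm n).aemeasurable (by fun_prop)] at h2
    rw [charFun_apply_real, integral_map (hYm n).aemeasurable (by fun_prop)]
    simpa using h2
  simp only [Complex.ofReal_one, one_mul] at h
  rw [h, Finset.prod_congr rfl fun n _ => h1 n, ← Complex.exp_sum, Complex.ofReal_sum,
    Finset.mul_sum]

/-- Joint characteristic function of finitely many series `∑ a_i(n) Z_n`. -/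
theorem integral_cexp_sum_inner_of_tendsto [IsProbabilityMeasure P] {ι : Type*} [Fintype ι]
    {Q : H →L[ℝ] H}
    {Z : ℕ → Ω → H} (hZm : ∀ n, Measurable (Z n))
    (hZi : iIndepFun Z P) (hZ : ∀ n, IsGaussianLaw (P.map (Z n)) 0 Q)
    {a : ι → ℕ → ℝ} {c : ι → ι → ℝ} (hc : ∀ i j, HasSum (fun n => a i n * a j n) (c i j))
    {X : ι → Ω → H} (hX : ∀ᵐ ω ∂P, ∀ i,
      Tendsto (fun N => ∑ n ∈ Finset.range N, a i n • Z n ω) atTop (𝓝 (X i ω))) (h : ι → H) :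
    ∫ ω, Complex.exp (((∑ i, ⟪X i ω, h i⟫_ℝ : ℝ) : ℂ) * Complex.I) ∂P =
      Complex.exp (-(1 / 2) * ((∑ i, ∑ j, c i j * ⟪Q (h i), h j⟫_ℝ : ℝ) : ℂ)) := by
  have : SecondCountableTopology H := UniformSpace.secondCountable_of_separable H
  let g : ℕ → H := fun n => ∑ i, a i n • h i
  have hg : ∀ N ω, ∑ n ∈ Finset.range N, ⟪Z n ω, g n⟫_ℝ =
      ∑ i, ⟪∑ n ∈ Finset.range N, a i n • Z n ω, h i⟫_ℝ := by
    intro N ω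
    simp only [g, inner_sum, sum_inner, real_inner_smul_left, real_inner_smul_right]
    exact Finset.sum_comm
  have hQg : ∀ n, ⟪Q (g n), g n⟫_ℝ = ∑ i, ∑ j, (a i n * a j n) * ⟪Q (h i), h j⟫_ℝ := by
    intro n
    simp only [g, map_sum, map_smul, inner_sum, sum_inner, real_inner_smul_left,
      real_inner_smul_right]
    rw [Finset.sum_comm]
    simp only [mul_assoc, mul_left_comm]
  have hlim : HasSum (fun n => ⟪Q (g n), g n⟫_ℝ) (∑ i, ∑ j, c i j * ⟪Q (h i), h j⟫_ℝ) := by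
    simp only [hQg]
    exact hasSum_sum fun i _ => hasSum_sum fun j _ => (hc i j).mul_right _
  have hR : Tendsto (fun N => Complex.exp (-(1 / 2) *
      ((∑ n ∈ Finset.range N, ⟪Q (g n), g n⟫_ℝ : ℝ) : ℂ))) atTop
      (𝓝 (Complex.exp (-(1 / 2) * ((∑ i, ∑ j, c i j * ⟪Q (h i), h j⟫_ℝ : ℝ) : ℂ)))) :=
    (Complex.continuous_exp.tendsto _).comp
      (((Complex.continuous_ofReal.tendsto _).comp hlim.tendsto_sum_nat).const_mul _)
  have hL : Tendsto (fun N => ∫ ω, Complex.exp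
      (((∑ n ∈ Finset.range N, ⟪Z n ω, g n⟫_ℝ : ℝ) : ℂ) * Complex.I) ∂P) atTop
      (𝓝 (∫ ω, Complex.exp (((∑ i, ⟪X i ω, h i⟫_ℝ : ℝ) : ℂ) * Complex.I) ∂P)) := by
    refine tendsto_integral_of_dominated_convergence (fun _ => 1) (fun N => ?_)
      (integrable_const _) (fun N => ?_) ?_
    · have : Measurable fun ω => ∑ n ∈ Finset.range N, ⟪Z n ω, g n⟫_ℝ :=
        Finset.measurable_fun_sum _ fun n _ => (hZm n).inner measurable_const
      fun_prop
    · exact Eventually.of_forall fun ω => (Complex.norm_exp_ofReal_mul_I _).le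
    · filter_upwards [hX] with ω hω
      simp only [hg]
      refine (Complex.continuous_exp.tendsto _).comp
        (((Complex.continuous_ofReal.tendsto _).comp ?_).mul_const _)
      exact tendsto_finsetSum _ fun i _ => (hω i).inner tendsto_const_nhds
  simp only [integral_cexp_sum_inner hZm hZi hZ] at hL
  exact tendsto_nhds_unique hL hR

end Gaussian

/-! ### The Wiener process -/

theorem tendsto_weight_smul {E : Type*} [NormedAddCommGroup E]
    [InnerProductSpace ℝ E] {α ρ K : ℝ} (hρ : 0 ≤ ρ) (hq : ρ * 2 ^ (α - 1 / 2) < 1) {z : ℕ → E}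
    (hz : ∀ n, ‖z n‖ ≤ K * ρ ^ level n) : Tendsto (fun n => weight α n • z n) atTop (𝓝 0) := by
  refine squeeze_zero_norm' ?_ (tendsto_const_mul_pow_level
    (q := ρ * 2 ^ (α - 1 / 2)) (by positivity) hq ((2 : ℝ) ^ (α - 1) * K))
  filter_upwards [eventually_ne_atTop 0] with n hn
  have hw : weight α n = 2 ^ (α - 1) * ((2 : ℝ) ^ (α - 1 / 2)) ^ level n := by
    rw [weight, if_neg hn, ← Real.rpow_natCast, ← Real.rpow_mul two_pos.le,
      ← Real.rpow_add two_pos]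
    ring_nf
  rw [norm_smul, hw, Real.norm_of_nonneg (by positivity), mul_pow]
  calc _ ≤ 2 ^ (α - 1) * ((2 : ℝ) ^ (α - 1 / 2)) ^ level n * (K * ρ ^ level n) := by
        gcongr
        exact hz n
    _ = _ := by ring

section Wiener

variable {H : Type*} [NormedAddCommGroup H] [InnerProductSpace ℝ H] [CompleteSpace H]
  [TopologicalSpace.SeparableSpace H] [MeasurableSpace H] [BorelSpace H]
  {Ω : Type*} [MeasurableSpace Ω] {P : Measure Ω} [IsProbabilityMeasure P]

theorem ae_exists_norm_le_of_isGaussianLaw {Q : H →L[ℝ] H} (hQ : Q.IsPositive) {Z : ℕ → Ω → H}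
    (hZm : ∀ n, Measurable (Z n)) (hZ : ∀ n, IsGaussianLaw (P.map (Z n)) 0 Q) {ρ : ℝ}
    (hρ : 1 < ρ) : ∀ᵐ ω ∂P, ∃ K : ℝ, ∀ n, ‖Z n ω‖ ≤ K * ρ ^ level n :=
  ae_exists_norm_le_mul_pow_level hZm (fun n => (hZ n).eq (hZ 0))
    (fun p => (hZ 0).lintegral_enorm_pow_ne_top hQ p) hρ

/-- The joint characteristic function of increments over consecutive intervals `(s_i, t_i]` factors,
because by Parseval's identity the coefficient sequences `(φ_n(t_i) - φ_n(s_i))_n` are orthogonal in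
`ℓ²`, with squared norms `t_i - s_i`. -/
theorem isQWiener_schauderSum {Q : H →L[ℝ] H} {Z : ℕ → Ω → H} (hZm : ∀ n, Measurable (Z n))
    (hZi : iIndepFun Z P) (hZ : ∀ n, IsGaussianLaw (P.map (Z n)) 0 Q)
    (hconv : ∀ᵐ ω ∂P, TendstoUniformly (schauderPartialSum fun n => Z n ω)
      (schauderSum fun n => Z n ω) atTop) :
    IsQWiener Q (fun t ω => schauderSum (fun n => Z n ω) t) P := by
  have : SecondCountableTopology H := UniformSpace.secondCountable_of_separable H
  have hm : ∀ t, Measurable fun ω => schauderSum (fun n => Z n ω) t := fun t =>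
    (measurable_schauderSum t).comp (measurable_pi_lambda _ hZm)
  have hmi : ∀ s t, Measurable fun ω =>
      schauderSum (fun n => Z n ω) t - schauderSum (fun n => Z n ω) s := fun s t =>
    (hm t).sub (hm s)
  -- An increment of `W` is almost surely the series of the `Z n` whose coefficients are the
  -- increments of the Schauder functions.
  have hincr : ∀ {ι : Type} (s t : ι → I), ∀ᵐ ω ∂P, ∀ i,
      Tendsto (fun N => ∑ n ∈ Finset.range N, (schauder n (t i) - schauder n (s i)) • Z n ω) atTop
        (𝓝 (schauderSum (fun n => Z n ω) (t i) - schauderSum (fun n => Z n ω) (s i))) := by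
    intro ι s t
    filter_upwards [hconv] with ω hω i
    simpa only [← schauderPartialSum_sub_apply (fun n => Z n ω)] using
      (hω.tendsto_at (t i)).sub (hω.tendsto_at (s i))
  have hlaw : ∀ s t : I, s ≤ t → ∀ h : H,
      charFun (P.map fun ω => schauderSum (fun n => Z n ω) t - schauderSum (fun n => Z n ω) s) h =
        Complex.exp (-(1 / 2) * ((((t : ℝ) - s) * ⟪Q h, h⟫_ℝ : ℝ) : ℂ)) := by
    intro s t hst h
    have hst' : (s : ℝ) ≤ t := hst
    have hi := integral_cexp_sum_inner_of_tendsto hZm hZi hZ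
      (c := fun _ _ : Unit => (t : ℝ) - s) (fun _ _ => by
        have := hasSum_schauder_sub_mul_schauder_sub s t s t
        rwa [min_self, min_self, min_eq_right hst', min_eq_left hst', sub_add_cancel] at this)
      (hincr (fun _ : Unit => s) (fun _ => t)) (fun _ => h)
    rw [charFun_apply, integral_map (hmi s t).aemeasurable (by fun_prop)]
    simpa only [Finset.univ_unique, Finset.sum_singleton] using hi
  refine ⟨hm, fun ω => schauderSum_apply_zero _, fun ω => continuous_schauderSum _,
    fun m τ hτ => ?_, fun s t hst h => ?_⟩
  · rw [iIndepFun_iff_charFun_pi fun i => (hmi _ _).aemeasurable]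
    intro h
    have hmono : ∀ i : Fin m, τ i.castSucc ≤ τ i.succ := fun i => hτ (Fin.castSucc_le_succ i)
    have hi := integral_cexp_sum_inner_of_tendsto hZm hZi hZ
      (c := fun i j : Fin m => if i = j then (τ i.succ : ℝ) - τ i.castSucc else 0) (fun i j => by
        have h1 := hasSum_schauder_sub_mul_schauder_sub (τ i.castSucc) (τ i.succ)
          (τ j.castSucc) (τ j.succ)
        convert! h1 using 1
        have hi' : (τ i.castSucc : ℝ) ≤ τ i.succ := hmono i
        have hj' : (τ j.castSucc : ℝ) ≤ τ j.succ := hmono j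
        rcases lt_trichotomy i j with hij | rfl | hij
        · have h2 : (τ i.succ : ℝ) ≤ τ j.castSucc := hτ (Fin.le_def.2 (Nat.succ_le_of_lt hij))
          rw [if_neg hij.ne, min_eq_left (h2.trans hj'), min_eq_left h2,
            min_eq_left ((hi'.trans h2).trans hj'), min_eq_left (hi'.trans h2)]
          ring
        · rw [if_pos rfl, min_self, min_self, min_eq_right hi', min_eq_left hi']
          ring
        · have h2 : (τ j.succ : ℝ) ≤ τ i.castSucc := hτ (Fin.le_def.2 (Nat.succ_le_of_lt hij))
          rw [if_neg hij.ne', min_eq_right (h2.trans hi'), min_eq_right h2,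
            min_eq_right ((hj'.trans h2).trans hi'), min_eq_right (hj'.trans h2)]
          ring)
      (hincr (fun i : Fin m => τ i.castSucc) (fun i => τ i.succ)) (fun i => h i)
    rw [Finset.prod_congr rfl fun i _ => hlaw _ _ (hmono i) (h i), ← Complex.exp_sum,
      charFun_apply, integral_map ?_ (by fun_prop)]
    · simp only [PiLp.inner_apply]
      rw [hi, ← Finset.mul_sum, ← Complex.ofReal_sum]
      simp
    · have : Measurable fun ω => fun i : Fin m => schauderSum (fun n => Z n ω) (τ i.succ) -
          schauderSum (fun n => Z n ω) (τ i.castSucc) := measurable_pi_lambda _ fun i => hmi _ _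
      fun_prop
  · rw [hlaw s t hst]
    congr 1
    simp only [inner_zero_right, smul_apply, real_inner_smul_left]
    simp

end Wiener

end SchauderWiener

theorem mainTheorem5
    {H : Type*} [NormedAddCommGroup H] [InnerProductSpace ℝ H] [CompleteSpace H]
    [TopologicalSpace.SeparableSpace H] [MeasurableSpace H] [BorelSpace H]
    {Ω : Type*} [MeasurableSpace Ω] (P : Measure Ω) [IsProbabilityMeasure P]
    (Q : H →L[ℝ] H) (hQ : Q.IsPositive) (hQtr : SchauderWiener.HasFiniteTrace Q)
    (α : ℝ≥0) (hα0 : 0 < α) (hα : (α : ℝ) < 1 / 2)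
    (Z : ℕ → Ω → H) (hZm : ∀ n, Measurable (Z n)) (hZi : iIndepFun Z P)
    (hZ : ∀ n, SchauderWiener.IsGaussianLaw (P.map (Z n)) 0 Q)
    (W : I → Ω → H)
    (hW : W = fun t ω => SchauderWiener.schauderSum (fun n => Z n ω) t) :
    (∀ᵐ ω ∂P,
      MemHolder α (fun t => W t ω) ∧
      Tendsto (fun N => eHolderNorm α
        (fun t => SchauderWiener.schauderPartialSum (fun n => Z n ω) N t - W t ω))
        atTop (𝓝 0) ∧
      TendstoUniformly (SchauderWiener.schauderPartialSum fun n => Z n ω)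
        (fun t => W t ω) atTop) ∧
    SchauderWiener.IsQWiener Q W P ∧
    (∀ᵐ ω ∂P,
      SchauderWiener.IsLittleHolder α (fun t => W t ω) ∧
      SchauderWiener.ciesielski α (fun t => W t ω) = (fun n => SchauderWiener.weight α n • Z n ω) ∧
      Tendsto (SchauderWiener.ciesielski α (fun t => W t ω)) atTop (𝓝 0)) := by
  subst hW
  -- An exponent `β` strictly between `α` and `1 / 2` yields the little Hölder property, and the
  -- growth rate `ρ > 1` of `‖Z n‖` leaves room for convergence in the Hölder norm of order `β`.
  obtain ⟨β, hαβ, hβ⟩ : ∃ β : ℝ≥0, α < β ∧ (β : ℝ) < 1 / 2 := by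
    obtain ⟨b, hb1, hb2⟩ := exists_between hα
    exact ⟨⟨b, α.2.trans hb1.le⟩, hb1, hb2⟩
  have hβ1 : β ≤ 1 := by
    have : (β : ℝ) ≤ 1 := by linarith
    exact_mod_cast this
  obtain ⟨ρ, hρ1, hρβ⟩ : ∃ ρ : ℝ, 1 < ρ ∧ ρ * 2 ^ ((β : ℝ) - 1 / 2) < 1 := by
    refine ⟨2 ^ ((1 / 2 - (β : ℝ)) / 2), Real.one_lt_rpow one_lt_two (by linarith), ?_⟩
    rw [← Real.rpow_add two_pos]
    exact Real.rpow_lt_one_of_one_lt_of_neg one_lt_two (by linarith)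
  have hρ0 : 0 ≤ ρ := by linarith
  have hρα : ρ * 2 ^ ((α : ℝ) - 1 / 2) < 1 := by
    refine lt_of_le_of_lt ?_ hρβ
    gcongr
    exact one_le_two
  have hgrowth := SchauderWiener.ae_exists_norm_le_of_isGaussianLaw hQ hZm hZ hρ1
  have hunif : ∀ᵐ ω ∂P, TendstoUniformly (SchauderWiener.schauderPartialSum fun n => Z n ω)
      (SchauderWiener.schauderSum fun n => Z n ω) atTop := by
    filter_upwards [hgrowth] with ω ⟨K, hK⟩
    exact SchauderWiener.tendstoUniformly_schauderSum β.2 hβ1 hρ0 hρβ hK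
  refine ⟨?_, SchauderWiener.isQWiener_schauderSum hZm hZi hZ hunif, ?_⟩
  · filter_upwards [hgrowth, hunif] with ω ⟨K, hK⟩ hω
    have hα1 := hαβ.le.trans hβ1
    exact ⟨SchauderWiener.memHolder_schauderSum hα1 hρ0 hρα hK,
      SchauderWiener.tendsto_eHolderNorm_schauderPartialSum_sub hα1 hρ0 hρα hK, hω⟩
  · filter_upwards [hgrowth, hunif] with ω ⟨K, hK⟩ hω
    have hcoeff : SchauderWiener.ciesielski α (SchauderWiener.schauderSum fun n => Z n ω) =
        fun n => SchauderWiener.weight α n • Z n ω := by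
      funext n
      rw [SchauderWiener.ciesielski, SchauderWiener.haarCoeff_eq_of_tendsto hω.tendsto_at]
    refine ⟨SchauderWiener.isLittleHolder_of_memHolder (by exact_mod_cast hαβ)
      (SchauderWiener.schauderSum_apply_zero _)
      (SchauderWiener.memHolder_schauderSum hβ1 hρ0 hρβ hK), hcoeff, ?_⟩
    rw [hcoeff]
    exact SchauderWiener.tendsto_weight_smul hρ0 hρα hK
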